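/- Let $\Omega\subset\mathbb{R}^2$ be a bounded open set which is weakly Lipschitz: for every $y\in\partial\Omega$ there are a neighbourhood $V_y$ of $y$ and a bilipschitz map $\rho_y:\mathbb{R}^2\to\mathbb{R}^2$ such that, inside $V_y$, the sets $\Omega$, $\mathbb{R}^2\setminus\overline\Omega$ and $\partial\Omega$ coincide with the images under $\rho_y$ of $\{x_2>0\}$, $\{x_2<0\}$ and $\{x_2=0\}$, respectively. Let $\omega\in\mathbb{C}$, $\omega\neq 0$. All derivatives are in the sense of distributions, $\operatorname{div} f=\partial_1f_1+\partial_2f_2$ and $\operatorname{curl} f=\partial_1f_2-\partial_2f_1$. Put $$H_{\mathrm{div}}=\{f\in L_2(\Omega;\mathbb{C}^2):\operatorname{div} f\in L_2(\Omega)\},\qquad H_{\mathrm{curl}}=\{f\in L_2(\Omega;\mathbb{C}^2):\operatorname{curl} f\in L_2(\Omega)\},$$ and, with $\tilde f$ the zero extension of $f$ to $\mathbb{R}^2$, $$H^0_{\mathrm{div}}=\{f\in H_{\mathrm{div}}:\operatorname{div}\tilde f\in L_2(\mathbb{R}^2)\},\qquad H^0_{\mathrm{curl}}=\{f\in H_{\mathrm{curl}}:\operatorname{curl}\tilde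 f\in L_2(\mathbb{R}^2)\}.$$ Let $H^1_0(\Omega)$ be the closure of $C_c^\infty(\Omega)$ in $H^1(\Omega)$. Let $\nabla,\nabla_0,\operatorname{div},\operatorname{div}_0$ be the gradient and divergence operators with domains $H^1(\Omega)$, $H^1_0(\Omega)$, $H_{\mathrm{div}}$, $H^0_{\mathrm{div}}$, and $J=\begin{bmatrix}0&-1\\1&0\end{bmatrix}$. Let $D$ be the operator in $L_2(\Omega;\mathbb{C}^6)=L_2(\Omega)\times L_2(\Omega;\mathbb{C}^2)\times L_2(\Omega)\times L_2(\Omega;\mathbb{C}^2)$ $$D=\begin{bmatrix}0&\operatorname{div}_0&0&0\\-\nabla&0&0&i\omega J\\0&0&0&\operatorname{div}\\0&-i\omega J&-\nabla_0&0\end{bmatrix}$$ with domain $H^1(\Omega)\times H^0_{\mathrm{div}}\times H^1_0(\Omega)\times H_{\mathrm{div}}$. Then the range of $D$ is $$\mathbf{R}(D)=\left\{(f_\perp,f_\parallel,g_\perp,g_\parallel)\in L_2(\Omega;\mathbb{C}^6):\ f_\parallel\in H_{\mathrm{curl}},\ g_\parallel\in H^0_{\mathrm{curl}},\ \operatorname{curl}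 f_\parallel-i\omega g_\perp=0,\ \operatorname{curl} g_\parallel+i\omega f_\perp=0\right\}.$$ -/

import Mathlib

open MeasureTheory Topology TopologicalSpace
open scoped NNReal ENNReal

noncomputable section

namespace Waveguide

/-! ### Weakly Lipschitz domains in the plane -/

abbrev Plane : Type := EuclideanSpace ℝ (Fin 2)

/-- `C²` with its Hermitian norm. -/
abbrev C2 : Type := EuclideanSpace ℂ (Fin 2)

/-- An open set `Ω = Ω⁺` of the plane is weakly Lipschitz if near every point `y` of its boundary
there is a global bilipschitz map `ρ` of the plane that takes the half planes `{±x₂ > 0}` and the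
line `{x₂ = 0}` to `Ω⁺`, to the exterior domain `Ω⁻` (the complement of the closure) and to the
boundary, inside a neighbourhood of `y`. -/
def IsWeaklyLipschitz (Ω : Opens Plane) : Prop :=
  ∀ y ∈ frontier (Ω : Set Plane), ∃ V ∈ 𝓝 y, ∃ ρ : Plane → Plane,
    (∃ K : ℝ≥0, LipschitzWith K ρ) ∧ (∃ K : ℝ≥0, AntilipschitzWith K ρ) ∧
    (Ω : Set Plane) ∩ V = ρ '' {x | 0 < x 1} ∩ V ∧
    (closure (Ω : Set Plane))ᶜ ∩ V = ρ '' {x | x 1 < 0} ∩ V ∧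
    frontier (Ω : Set Plane) ∩ V = ρ '' {x | x 1 = 0} ∩ V

/-! ### Weak derivatives -/

/-- Complex valued smooth functions with compact support in `U`. -/
abbrev TestFn (U : Opens Plane) : Type := TestFunction U ℂ (⊤ : ℕ∞)

/-- The classical partial derivative `∂ⱼ φ`. -/
def pderiv (j : Fin 2) (φ : Plane → ℂ) (x : Plane) : ℂ :=
  fderiv ℝ φ x (EuclideanSpace.single j (1 : ℝ))

/-- `∇ u = g` in the sense of distributions on `U`. -/
def HasWeakGrad (U : Opens Plane) (u : Plane → ℂ) (g : Plane → C2) : Prop :=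
  ∀ φ : TestFn U, ∀ j : Fin 2,
    ∫ x in (U : Set Plane), pderiv j φ x * u x = - ∫ x in (U : Set Plane), φ x * g x j

/-- `div f = ∂₁ f₁ + ∂₂ f₂ = h` in the sense of distributions on `U`. -/
def HasWeakDiv (U : Opens Plane) (f : Plane → C2) (h : Plane → ℂ) : Prop :=
  ∀ φ : TestFn U,
    ∫ x in (U : Set Plane), (pderiv 0 φ x * f x 0 + pderiv 1 φ x * f x 1) =
      - ∫ x in (U : Set Plane), φ x * h x

/-- `curl f = ∂₁ f₂ - ∂₂ f₁ = h` in the sense of distributions on `U`. -/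
def HasWeakCurl (U : Opens Plane) (f : Plane → C2) (h : Plane → ℂ) : Prop :=
  ∀ φ : TestFn U,
    ∫ x in (U : Set Plane), (pderiv 0 φ x * f x 1 - pderiv 1 φ x * f x 0) =
      - ∫ x in (U : Set Plane), φ x * h x

/-! ### The `L₂` spaces -/

/-- `L₂(Ω)`. -/
abbrev L2 (Ω : Opens Plane) : Type := Lp ℂ 2 (volume.restrict (Ω : Set Plane))

/-- `L₂(Ω; C²)`. -/
abbrev L2v (Ω : Opens Plane) : Type := Lp C2 2 (volume.restrict (Ω : Set Plane))

/-- `L₂(Ω; C⁶)`, its elements written as `(f_⊥, f_∥, g_⊥, g_∥)` according to the splitting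
`C⁶ = C ⊕ C² ⊕ C ⊕ C²`. -/
abbrev L2six (Ω : Opens Plane) : Type := L2 Ω × L2v Ω × L2 Ω × L2v Ω

/-- The zero extension of a function on `Ω` to the plane. -/
def zeroExt (Ω : Opens Plane) (f : Plane → C2) : Plane → C2 := (Ω : Set Plane).indicator f

/-! Auxiliary facts: the pairings of `L₂` functions with test functions are linear, and an `L₂`
function is determined by its pairings. -/

section aux

variable {Ω U : Opens Plane}

lemma continuous_pderiv (j : Fin 2) (φ : TestFn U) : Continuous (pderiv j φ) := by
  have h : Continuous (fderiv ℝ (φ : Plane → ℂ)) :=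
    (φ.contDiff).continuous_fderiv (by simp)
  exact h.clm_apply continuous_const

lemma hasCompactSupport_pderiv (j : Fin 2) (φ : TestFn U) : HasCompactSupport (pderiv j φ) :=
  φ.hasCompactSupport.fderiv_apply (𝕜 := ℝ) _

lemma continuous_testFn (φ : TestFn U) : Continuous (φ : Plane → ℂ) := φ.contDiff.continuous

lemma memLp_comp_apply {μ : Measure Plane} (f : Lp C2 2 μ) (j : Fin 2) :
    MemLp (fun x => f x j) 2 μ :=
  (EuclideanSpace.proj (𝕜 := ℂ) j : C2 →L[ℂ] ℂ).comp_memLp' (Lp.memLp f)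

lemma integrable_mul_of {s : Set Plane} {a u : Plane → ℂ} (ha : Continuous a)
    (hc : HasCompactSupport a) (hu : MemLp u 2 (volume.restrict s)) :
    Integrable (fun x => a x * u x) (volume.restrict s) :=
  (ha.memLp_of_hasCompactSupport (p := 2) hc).integrable_mul hu

lemma pairing_add {s : Set Plane} {a u v w : Plane → ℂ} (ha : Continuous a)
    (hc : HasCompactSupport a) (hu : MemLp u 2 (volume.restrict s))
    (hv : MemLp v 2 (volume.restrict s)) (hw : w =ᵐ[volume.restrict s] u + v) :
    ∫ x in s, a x * w x = (∫ x in s, a x * u x) + ∫ x in s, a x * v x := by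
  rw [← integral_add (integrable_mul_of ha hc hu) (integrable_mul_of ha hc hv)]
  refine integral_congr_ae ?_
  filter_upwards [hw] with x hx
  simp [hx, mul_add]

lemma pairing_smul {s : Set Plane} {a u w : Plane → ℂ} (c : ℂ)
    (hw : w =ᵐ[volume.restrict s] c • u) :
    ∫ x in s, a x * w x = c * ∫ x in s, a x * u x := by
  rw [← integral_const_mul]
  refine integral_congr_ae ?_
  filter_upwards [hw] with x hx
  simp [hx]; ring

lemma coe_add_apply {μ : Measure Plane} (f g : Lp C2 2 μ) (j : Fin 2) :
    (fun x => (f + g : Lp C2 2 μ) x j) =ᵐ[μ] (fun x => f x j) + fun x => g x j := by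
  filter_upwards [Lp.coeFn_add f g] with x hx
  rw [hx]
  rfl

lemma coe_smul_apply {μ : Measure Plane} (c : ℂ) (f : Lp C2 2 μ) (j : Fin 2) :
    (fun x => (c • f : Lp C2 2 μ) x j) =ᵐ[μ] c • fun x => f x j := by
  filter_upwards [Lp.coeFn_smul c f] with x hx
  rw [hx]
  rfl

lemma eq_zero_of_pairing {u : Plane → ℂ} (hu : MemLp u 2 (volume.restrict (Ω : Set Plane)))
    (h : ∀ φ : TestFn Ω, ∫ x in (Ω : Set Plane), φ x * u x = 0) :
    u =ᵐ[volume.restrict (Ω : Set Plane)] 0 := by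
  have hl : LocallyIntegrableOn u (Ω : Set Plane) volume := by
    refine (locallyIntegrableOn_of_locallyIntegrable_restrict ?_)
    exact hu.locallyIntegrable (by norm_num)
  have := Ω.isOpen.ae_eq_zero_of_integral_contDiff_smul_eq_zero hl ?_
  · exact (ae_restrict_iff' Ω.isOpen.measurableSet).2 this
  · intro g hg hgc hgs
    have hsup : Function.support (fun x => (g x : ℂ)) = Function.support g := by
      ext x; simp
    have hts : tsupport (fun x => (g x : ℂ)) = tsupport g := by
      rw [tsupport, tsupport, hsup]
    let φ : TestFn Ω :=
      { toFun := fun x => (g x : ℂ)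
        contDiff' := Complex.ofRealCLM.contDiff.comp hg
        hasCompactSupport' := by rw [HasCompactSupport, hts]; exact hgc
        tsupport_subset' := by rw [hts]; exact hgs }
    have h1 := h φ
    rw [← h1, ← integral_indicator Ω.isOpen.measurableSet]
    refine integral_congr_ae (Filter.Eventually.of_forall fun x => ?_)
    by_cases hx : x ∈ (Ω : Set Plane)
    · rw [Set.indicator_of_mem hx]
      exact Complex.real_smul
    · have : g x = 0 := image_eq_zero_of_notMem_tsupport fun hx' => hx (hgs hx')
      simp [hx, this]

/-- Pairings of `L₂` vector fields with a pair of test functions. -/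
lemma pairing2_split {s : Set Plane} {a b : Plane → ℂ} (ha : Continuous a)
    (hca : HasCompactSupport a) (hb : Continuous b) (hcb : HasCompactSupport b)
    (f : Lp C2 2 (volume.restrict s)) :
    ∫ x in s, (a x * f x 0 + b x * f x 1) = (∫ x in s, a x * f x 0) + ∫ x in s, b x * f x 1 :=
  integral_add (integrable_mul_of ha hca (memLp_comp_apply f 0))
    (integrable_mul_of hb hcb (memLp_comp_apply f 1))

lemma pairing2_add {s : Set Plane} {a b : Plane → ℂ} (ha : Continuous a)
    (hca : HasCompactSupport a) (hb : Continuous b) (hcb : HasCompactSupport b)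
    (f g : Lp C2 2 (volume.restrict s)) :
    ∫ x in s, (a x * (f + g : Lp C2 2 _) x 0 + b x * (f + g : Lp C2 2 _) x 1) =
      (∫ x in s, (a x * f x 0 + b x * f x 1)) + ∫ x in s, (a x * g x 0 + b x * g x 1) := by
  simp only [pairing2_split ha hca hb hcb]
  rw [pairing_add ha hca (memLp_comp_apply f 0) (memLp_comp_apply g 0) (coe_add_apply f g 0),
    pairing_add hb hcb (memLp_comp_apply f 1) (memLp_comp_apply g 1) (coe_add_apply f g 1)]
  ring

lemma pairing2_smul {s : Set Plane} {a b : Plane → ℂ} (ha : Continuous a)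
    (hca : HasCompactSupport a) (hb : Continuous b) (hcb : HasCompactSupport b)
    (c : ℂ) (f : Lp C2 2 (volume.restrict s)) :
    ∫ x in s, (a x * (c • f : Lp C2 2 _) x 0 + b x * (c • f : Lp C2 2 _) x 1) =
      c * ∫ x in s, (a x * f x 0 + b x * f x 1) := by
  simp only [pairing2_split ha hca hb hcb]
  rw [pairing_smul c (coe_smul_apply c f 0), pairing_smul c (coe_smul_apply c f 1)]
  ring

lemma curl_integrand (φ : TestFn U) (f : Plane → C2) :
    (fun x => pderiv 0 φ x * f x 1 - pderiv 1 φ x * f x 0) =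
      fun x => (-pderiv 1 φ) x * f x 0 + pderiv 0 φ x * f x 1 := by
  funext x; simp; ring

lemma setIntegral_zeroExt (a b : Plane → ℂ) (f : Plane → C2) :
    ∫ x in ((⊤ : Opens Plane) : Set Plane), (a x * zeroExt Ω f x 0 + b x * zeroExt Ω f x 1) =
      ∫ x in (Ω : Set Plane), (a x * f x 0 + b x * f x 1) := by
  rw [Opens.coe_top, Measure.restrict_univ, ← integral_indicator Ω.isOpen.measurableSet]
  congr 1
  funext x
  by_cases hx : x ∈ (Ω : Set Plane) <;> simp [zeroExt, hx]

lemma memLp_top (h : Lp ℂ 2 (volume : Measure Plane)) :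
    MemLp h 2 (volume.restrict ((⊤ : Opens Plane) : Set Plane)) := by
  simpa using Lp.memLp h

end aux

/-! ### The differential operators as unbounded operators in `L₂`

Each operator is given by its graph, which is the graph of a (single valued) linear operator by
the `..._single_valued` lemmas. -/

section operators

variable (Ω : Opens Plane)

/-- The pairs `(u, ∇ u)` with `u ∈ L₂(Ω)`, `∇ u ∈ L₂(Ω; C²)`. -/
def gradGraph : Submodule ℂ (L2 Ω × L2v Ω) where
  carrier := {p | HasWeakGrad Ω p.1 p.2}
  zero_mem' := by
    intro φ j
    have h1 := pairing_smul (a := pderiv j φ) 0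
      (show ((0 : L2 Ω) : Plane → ℂ) =ᵐ[volume.restrict (Ω : Set Plane)] (0 : ℂ) • (0 : Plane → ℂ) by
        rw [zero_smul]; exact Lp.coeFn_zero _ _ _)
    have h2 := pairing_smul (a := φ) 0 (coe_smul_apply 0 (0 : L2v Ω) j)
    rw [zero_smul, zero_mul] at h2
    rw [zero_mul] at h1
    rw [Prod.fst_zero, Prod.snd_zero, h1, h2, neg_zero]
  add_mem' := by
    intro p q hp hq φ j
    have h1 := pairing_add (continuous_pderiv j φ) (hasCompactSupport_pderiv j φ)
      (Lp.memLp p.1) (Lp.memLp q.1) (Lp.coeFn_add p.1 q.1)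
    have h2 := pairing_add (continuous_testFn φ) φ.hasCompactSupport
      (memLp_comp_apply p.2 j) (memLp_comp_apply q.2 j) (coe_add_apply p.2 q.2 j)
    rw [Prod.fst_add, Prod.snd_add, h1, h2, hp φ j, hq φ j]
    ring
  smul_mem' := by
    intro c p hp φ j
    have h1 := pairing_smul (a := pderiv j φ) c (Lp.coeFn_smul c p.1)
    have h2 := pairing_smul (a := φ) c (coe_smul_apply c p.2 j)
    rw [Prod.smul_fst, Prod.smul_snd, h1, h2, hp φ j]
    ring

/-- The pairs `(f, div f)` with `f ∈ L₂(Ω; C²)`, `div f ∈ L₂(Ω)`. -/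
def divGraph : Submodule ℂ (L2v Ω × L2 Ω) where
  carrier := {p | HasWeakDiv Ω p.1 p.2}
  zero_mem' := by
    intro φ
    have h1 := pairing2_smul (continuous_pderiv 0 φ) (hasCompactSupport_pderiv 0 φ)
      (continuous_pderiv 1 φ) (hasCompactSupport_pderiv 1 φ) 0 (0 : L2v Ω)
    have h2 := pairing_smul (a := φ) 0
      (show ((0 : L2 Ω) : Plane → ℂ) =ᵐ[volume.restrict (Ω : Set Plane)] (0 : ℂ) • (0 : Plane → ℂ) by
        rw [zero_smul]; exact Lp.coeFn_zero _ _ _)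
    rw [zero_smul, zero_mul] at h1
    rw [zero_mul] at h2
    rw [Prod.fst_zero, Prod.snd_zero, h1, h2, neg_zero]
  add_mem' := by
    intro p q hp hq φ
    have h1 := pairing2_add (continuous_pderiv 0 φ) (hasCompactSupport_pderiv 0 φ)
      (continuous_pderiv 1 φ) (hasCompactSupport_pderiv 1 φ) p.1 q.1
    have h2 := pairing_add (continuous_testFn φ) φ.hasCompactSupport
      (Lp.memLp p.2) (Lp.memLp q.2) (Lp.coeFn_add p.2 q.2)
    rw [Prod.fst_add, Prod.snd_add, h1, h2, hp φ, hq φ]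
    ring
  smul_mem' := by
    intro c p hp φ
    have h1 := pairing2_smul (continuous_pderiv 0 φ) (hasCompactSupport_pderiv 0 φ)
      (continuous_pderiv 1 φ) (hasCompactSupport_pderiv 1 φ) c p.1
    have h2 := pairing_smul (a := φ) c (Lp.coeFn_smul c p.2)
    rw [Prod.smul_fst, Prod.smul_snd, h1, h2, hp φ]
    ring

/-- The pairs `(f, curl f)` with `f ∈ L₂(Ω; C²)`, `curl f ∈ L₂(Ω)`. -/
def curlGraph : Submodule ℂ (L2v Ω × L2 Ω) where
  carrier := {p | HasWeakCurl Ω p.1 p.2}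
  zero_mem' := by
    intro φ
    have h1 := pairing2_smul (continuous_pderiv 1 φ).neg (hasCompactSupport_pderiv 1 φ).neg
      (continuous_pderiv 0 φ) (hasCompactSupport_pderiv 0 φ) 0 (0 : L2v Ω)
    have h2 := pairing_smul (a := φ) 0
      (show ((0 : L2 Ω) : Plane → ℂ) =ᵐ[volume.restrict (Ω : Set Plane)] (0 : ℂ) • (0 : Plane → ℂ) by
        rw [zero_smul]; exact Lp.coeFn_zero _ _ _)
    rw [zero_smul, zero_mul] at h1
    rw [zero_mul] at h2
    simp only [curl_integrand]
    rw [Prod.snd_zero, h2, neg_zero]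
    exact h1
  add_mem' := by
    intro p q hp hq φ
    have h1 := pairing2_add (continuous_pderiv 1 φ).neg (hasCompactSupport_pderiv 1 φ).neg
      (continuous_pderiv 0 φ) (hasCompactSupport_pderiv 0 φ) p.1 q.1
    have h2 := pairing_add (continuous_testFn φ) φ.hasCompactSupport
      (Lp.memLp p.2) (Lp.memLp q.2) (Lp.coeFn_add p.2 q.2)
    have hp' := hp φ
    have hq' := hq φ
    simp only [curl_integrand] at hp' hq' ⊢
    rw [Prod.fst_add, Prod.snd_add, h2]
    refine h1.trans ?_
    rw [hp', hq']
    ring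
  smul_mem' := by
    intro c p hp φ
    have h1 := pairing2_smul (continuous_pderiv 1 φ).neg (hasCompactSupport_pderiv 1 φ).neg
      (continuous_pderiv 0 φ) (hasCompactSupport_pderiv 0 φ) c p.1
    have h2 := pairing_smul (a := φ) c (Lp.coeFn_smul c p.2)
    have hp' := hp φ
    simp only [curl_integrand] at hp' ⊢
    rw [Prod.smul_fst, Prod.smul_snd, h2]
    refine h1.trans ?_
    rw [hp']
    ring

/-- The pairs `(φ, ∇ φ)` with `φ` a test function on `Ω`. -/
def testGraph : Submodule ℂ (L2 Ω × L2v Ω) where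
  carrier := {p | ∃ φ : TestFn Ω,
    (p.1 =ᵐ[volume.restrict (Ω : Set Plane)] φ) ∧
    ∀ j : Fin 2, (fun x => p.2 x j) =ᵐ[volume.restrict (Ω : Set Plane)] pderiv j φ}
  zero_mem' := by
    refine ⟨0, ?_, fun j => ?_⟩
    · exact Lp.coeFn_zero _ _ _
    · filter_upwards [Lp.coeFn_zero C2 2 (volume.restrict (Ω : Set Plane))] with x hx
      rw [Prod.snd_zero, hx]
      simp [pderiv]
  add_mem' := by
    rintro p q ⟨φ, hp, hp'⟩ ⟨ψ, hq, hq'⟩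
    refine ⟨φ + ψ, ?_, fun j => ?_⟩
    · filter_upwards [Lp.coeFn_add p.1 q.1, hp, hq] with x h hx hy
      rw [Prod.fst_add, h, Pi.add_apply, hx, hy]
      rfl
    · filter_upwards [coe_add_apply p.2 q.2 j, hp' j, hq' j] with x h hx hy
      rw [Prod.snd_add, h, Pi.add_apply, hx, hy]
      have h1 : DifferentiableAt ℝ (φ : Plane → ℂ) x :=
        (φ.contDiff.differentiable (by simp)).differentiableAt
      have h2 : DifferentiableAt ℝ (ψ : Plane → ℂ) x :=
        (ψ.contDiff.differentiable (by simp)).differentiableAt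
      have h3 : ((φ + ψ : TestFn Ω) : Plane → ℂ) = (φ : Plane → ℂ) + (ψ : Plane → ℂ) := rfl
      rw [h3, pderiv, pderiv, pderiv, fderiv_add h1 h2]
      rfl
  smul_mem' := by
    rintro c p ⟨φ, hp, hp'⟩
    refine ⟨c • φ, ?_, fun j => ?_⟩
    · filter_upwards [Lp.coeFn_smul c p.1, hp] with x h hx
      rw [Prod.smul_fst, h, Pi.smul_apply, hx]
      rfl
    · filter_upwards [coe_smul_apply c p.2 j, hp' j] with x h hx
      rw [Prod.smul_snd, h, Pi.smul_apply, hx]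
      have h1 : DifferentiableAt ℝ (φ : Plane → ℂ) x :=
        (φ.contDiff.differentiable (by simp)).differentiableAt
      have h3 : ((c • φ : TestFn Ω) : Plane → ℂ) = c • (φ : Plane → ℂ) := rfl
      rw [h3, pderiv, pderiv, fderiv_const_smul h1]
      rfl

lemma grad_single_valued (p : L2 Ω × L2v Ω) (hp : p ∈ gradGraph Ω) (h0 : p.1 = 0) : p.2 = 0 := by
  have key : ∀ j : Fin 2, (fun x => p.2 x j) =ᵐ[volume.restrict (Ω : Set Plane)] 0 := by
    intro j
    refine eq_zero_of_pairing (memLp_comp_apply p.2 j) fun φ => ?_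
    have h := hp φ j
    have h1 : ∫ x in (Ω : Set Plane), pderiv j φ x * p.1 x = 0 := by
      rw [h0, pairing_smul (u := 0) 0 (by rw [zero_smul]; exact Lp.coeFn_zero _ _ _), zero_mul]
    rw [h1] at h
    simpa using h.symm
  refine Lp.ext ?_
  filter_upwards [key 0, key 1, Lp.coeFn_zero C2 2 (volume.restrict (Ω : Set Plane))]
    with x h1 h2 h3
  rw [h3]
  ext j
  fin_cases j
  · exact h1
  · exact h2

lemma div_single_valued (p : L2v Ω × L2 Ω) (hp : p ∈ divGraph Ω) (h0 : p.1 = 0) : p.2 = 0 := by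
  refine Lp.ext (Filter.EventuallyEq.trans (eq_zero_of_pairing (Lp.memLp p.2) fun φ => ?_)
    (Lp.coeFn_zero _ _ _).symm)
  have h := hp φ
  have h1 := pairing2_smul (continuous_pderiv 0 φ) (hasCompactSupport_pderiv 0 φ)
    (continuous_pderiv 1 φ) (hasCompactSupport_pderiv 1 φ) 0 (0 : L2v Ω)
  rw [zero_smul, zero_mul] at h1
  rw [h0, h1] at h
  simpa using h.symm

lemma curl_single_valued (p : L2v Ω × L2 Ω) (hp : p ∈ curlGraph Ω) (h0 : p.1 = 0) :
    p.2 = 0 := by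
  refine Lp.ext (Filter.EventuallyEq.trans (eq_zero_of_pairing (Lp.memLp p.2) fun φ => ?_)
    (Lp.coeFn_zero _ _ _).symm)
  have h := hp φ
  have h1 := pairing2_smul (continuous_pderiv 1 φ).neg (hasCompactSupport_pderiv 1 φ).neg
    (continuous_pderiv 0 φ) (hasCompactSupport_pderiv 0 φ) 0 (0 : L2v Ω)
  rw [zero_smul, zero_mul] at h1
  simp only [curl_integrand] at h
  rw [h0] at h
  simpa using h.symm.trans h1

/-- `∇` with domain `H¹(Ω)`. -/
def grad : L2 Ω →ₗ.[ℂ] L2v Ω := (gradGraph Ω).toLinearPMap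

/-- `div` with domain `H_div(Ω; C²)`. -/
def div : L2v Ω →ₗ.[ℂ] L2 Ω := (divGraph Ω).toLinearPMap

/-- `curl` with domain `H_curl(Ω; C²)`. -/
def curl : L2v Ω →ₗ.[ℂ] L2 Ω := (curlGraph Ω).toLinearPMap

/-- `H¹(Ω)`: the `u ∈ L₂(Ω)` with `∇ u ∈ L₂(Ω; C²)`. -/
def H1 : Submodule ℂ (L2 Ω) := (grad Ω).domain

/-- `H_div(Ω; C²)`: the `f ∈ L₂(Ω; C²)` with `div f ∈ L₂(Ω)`. -/
def Hdiv : Submodule ℂ (L2v Ω) := (div Ω).domain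

/-- `H_curl(Ω; C²)`: the `f ∈ L₂(Ω; C²)` with `curl f ∈ L₂(Ω)`. -/
def Hcurl : Submodule ℂ (L2v Ω) := (curl Ω).domain

/-- `H¹₀(Ω)`, the closure of the test functions in `H¹(Ω)`: the `u ∈ H¹(Ω)` such that `(u, ∇ u)` is
a limit in `L₂(Ω) × L₂(Ω; C²)` of pairs `(φ, ∇ φ)` with test functions `φ` on `Ω`. -/
def H10 : Submodule ℂ (L2 Ω) :=
  (gradGraph Ω ⊓ (testGraph Ω).topologicalClosure).map (LinearMap.fst ℂ (L2 Ω) (L2v Ω))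

/-- `H⁰_div(Ω; C²)`: the `f ∈ H_div(Ω; C²)` whose zero extension has its divergence in `L₂(R²)`. -/
def H0div : Submodule ℂ (L2v Ω) where
  carrier := {f | f ∈ Hdiv Ω ∧
    ∃ h : Lp ℂ 2 (volume : Measure Plane), HasWeakDiv ⊤ (zeroExt Ω f) h}
  zero_mem' := by
    refine ⟨zero_mem _, 0, fun φ => ?_⟩
    have h1 := pairing2_smul (continuous_pderiv 0 φ) (hasCompactSupport_pderiv 0 φ)
      (continuous_pderiv 1 φ) (hasCompactSupport_pderiv 1 φ) 0 (0 : L2v Ω)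
    have h2 := pairing_smul (s := ((⊤ : Opens Plane) : Set Plane)) (a := φ) (u := 0)
      (w := ((0 : Lp ℂ 2 (volume : Measure Plane)) : Plane → ℂ)) 0
      (by rw [zero_smul, Opens.coe_top, Measure.restrict_univ]; exact Lp.coeFn_zero _ _ _)
    rw [zero_smul] at h1
    rw [setIntegral_zeroExt, h1, h2, zero_mul, zero_mul, neg_zero]
  add_mem' := by
    rintro f g ⟨hf, h, hh⟩ ⟨hg, k, hk⟩
    refine ⟨add_mem hf hg, h + k, fun φ => ?_⟩
    have h1 := pairing2_add (continuous_pderiv 0 φ) (hasCompactSupport_pderiv 0 φ)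
      (continuous_pderiv 1 φ) (hasCompactSupport_pderiv 1 φ) f g
    have h2 := pairing_add (w := ((h + k : Lp ℂ 2 (volume : Measure Plane)) : Plane → ℂ))
      (continuous_testFn φ) φ.hasCompactSupport (memLp_top h) (memLp_top k)
      (by rw [Opens.coe_top, Measure.restrict_univ]; exact Lp.coeFn_add h k)
    have e1 := hh φ
    have e2 := hk φ
    rw [setIntegral_zeroExt] at e1 e2 ⊢
    rw [h1, h2, e1, e2]
    ring
  smul_mem' := by
    rintro c f ⟨hf, h, hh⟩
    refine ⟨Submodule.smul_mem _ c hf, c • h, fun φ => ?_⟩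
    have h1 := pairing2_smul (continuous_pderiv 0 φ) (hasCompactSupport_pderiv 0 φ)
      (continuous_pderiv 1 φ) (hasCompactSupport_pderiv 1 φ) c f
    have h2 := pairing_smul (s := ((⊤ : Opens Plane) : Set Plane)) (a := φ) (u := h)
      (w := ((c • h : Lp ℂ 2 (volume : Measure Plane)) : Plane → ℂ)) c
      (by rw [Opens.coe_top, Measure.restrict_univ]; exact Lp.coeFn_smul c h)
    have e1 := hh φ
    rw [setIntegral_zeroExt] at e1 ⊢
    rw [h1, h2, e1]
    ring

/-- `H⁰_curl(Ω; C²)`: the `f ∈ H_curl(Ω; C²)` whose zero extension has its curl in `L₂(R²)`. -/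
def H0curl : Set (L2v Ω) :=
  {f | f ∈ Hcurl Ω ∧ ∃ h : Lp ℂ 2 (volume : Measure Plane), HasWeakCurl ⊤ (zeroExt Ω f) h}

lemma mem_H1_iff (u : L2 Ω) : u ∈ H1 Ω ↔ ∃ g : L2v Ω, HasWeakGrad Ω u g := by
  constructor
  · rintro ⟨p, hp, rfl⟩
    exact ⟨p.2, hp⟩
  · rintro ⟨h, hh⟩
    exact ⟨(_, h), hh, rfl⟩

lemma mem_Hdiv_iff (f : L2v Ω) : f ∈ Hdiv Ω ↔ ∃ h : L2 Ω, HasWeakDiv Ω f h := by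
  constructor
  · rintro ⟨p, hp, rfl⟩
    exact ⟨p.2, hp⟩
  · rintro ⟨h, hh⟩
    exact ⟨(_, h), hh, rfl⟩

lemma mem_Hcurl_iff (f : L2v Ω) : f ∈ Hcurl Ω ↔ ∃ h : L2 Ω, HasWeakCurl Ω f h := by
  constructor
  · rintro ⟨p, hp, rfl⟩
    exact ⟨p.2, hp⟩
  · rintro ⟨h, hh⟩
    exact ⟨(_, h), hh, rfl⟩

/-- `grad Ω` takes `u` to the weak gradient of `u`. -/
lemma hasWeakGrad_grad (u : H1 Ω) : HasWeakGrad Ω (u : L2 Ω) (grad Ω u) :=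
  Submodule.mem_graph_toLinearPMap (grad_single_valued Ω) u

/-- `div Ω` takes `f` to the weak divergence of `f`. -/
lemma hasWeakDiv_div (f : Hdiv Ω) : HasWeakDiv Ω (f : L2v Ω) (div Ω f) :=
  Submodule.mem_graph_toLinearPMap (div_single_valued Ω) f

/-- `curl Ω` takes `f` to the weak curl of `f`. -/
lemma hasWeakCurl_curl (f : Hcurl Ω) : HasWeakCurl Ω (f : L2v Ω) (curl Ω f) :=
  Submodule.mem_graph_toLinearPMap (curl_single_valued Ω) f

lemma H10_le_H1 : H10 Ω ≤ H1 Ω := Submodule.map_mono inf_le_left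

lemma H0div_le_Hdiv : H0div Ω ≤ Hdiv Ω := fun _ h => h.1

lemma H0curl_subset_Hcurl {f : L2v Ω} (h : f ∈ H0curl Ω) : f ∈ Hcurl Ω := h.1

/-- `∇₀`, the restriction of `∇` to `H¹₀(Ω)`. -/
def grad0 : L2 Ω →ₗ.[ℂ] L2v Ω :=
  ⟨H10 Ω, (grad Ω).toFun.comp (Submodule.inclusion (H10_le_H1 Ω))⟩

/-- `div₀`, the restriction of `div` to `H⁰_div(Ω; C²)`. -/
def div0 : L2v Ω →ₗ.[ℂ] L2 Ω :=
  ⟨H0div Ω, (div Ω).toFun.comp (Submodule.inclusion (H0div_le_Hdiv Ω))⟩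

/-- Pointwise multiplication by the matrix `J`. -/
def J : L2v Ω →L[ℂ] L2v Ω :=
  (Matrix.toEuclideanCLM (n := Fin 2) (𝕜 := ℂ) !![0, -1; 1, 0]).compLpL 2
    (volume.restrict (Ω : Set Plane))

/-- The Maxwell operator
`D = [0, div₀, 0, 0; -∇, 0, 0, iωJ; 0, 0, 0, div; 0, -iωJ, -∇₀, 0]` in `L₂(Ω; C⁶)`,
with domain `H¹ × H⁰_div × H¹₀ × H_div`. -/
def maxwellD (ω : ℂ) : L2six Ω →ₗ.[ℂ] L2six Ω where
  domain := (H1 Ω).prod ((H0div Ω).prod ((H10 Ω).prod (Hdiv Ω)))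
  toFun :=
    { toFun := fun F =>
        (div0 Ω ⟨F.1.2.1, F.2.2.1⟩,
          -grad Ω ⟨F.1.1, F.2.1⟩ + (Complex.I * ω) • J Ω F.1.2.2.2,
          div Ω ⟨F.1.2.2.2, F.2.2.2.2⟩,
          -((Complex.I * ω) • J Ω F.1.2.1) - grad0 Ω ⟨F.1.2.2.1, F.2.2.2.1⟩)
      map_add' := by
        intro F G
        have e1 := (div0 Ω).map_add ⟨F.1.2.1, F.2.2.1⟩ ⟨G.1.2.1, G.2.2.1⟩
        have e2 := (grad Ω).map_add ⟨F.1.1, F.2.1⟩ ⟨G.1.1, G.2.1⟩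
        have e3 := (div Ω).map_add ⟨F.1.2.2.2, F.2.2.2.2⟩ ⟨G.1.2.2.2, G.2.2.2.2⟩
        have e4 := (grad0 Ω).map_add ⟨F.1.2.2.1, F.2.2.2.1⟩ ⟨G.1.2.2.1, G.2.2.2.1⟩
        refine Prod.ext e1 (Prod.ext ?_ (Prod.ext e3 ?_))
        · refine (congrArg₂ (fun a b => -a + (Complex.I * ω) • b) e2
            ((J Ω).map_add F.1.2.2.2 G.1.2.2.2)).trans ?_
          simp only [Prod.snd_add, Prod.fst_add, smul_add]
          abel
        · refine (congrArg₂ (fun a b => -((Complex.I * ω) • b) - a) e4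
            ((J Ω).map_add F.1.2.1 G.1.2.1)).trans ?_
          simp only [Prod.snd_add, smul_add]
          abel
      map_smul' := by
        intro c F
        have e1 := (div0 Ω).map_smul c ⟨F.1.2.1, F.2.2.1⟩
        have e2 := (grad Ω).map_smul c ⟨F.1.1, F.2.1⟩
        have e3 := (div Ω).map_smul c ⟨F.1.2.2.2, F.2.2.2.2⟩
        have e4 := (grad0 Ω).map_smul c ⟨F.1.2.2.1, F.2.2.2.1⟩
        refine Prod.ext e1 (Prod.ext ?_ (Prod.ext e3 ?_))
        · refine (congrArg₂ (fun a b => -a + (Complex.I * ω) • b) e2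
            ((J Ω).map_smul c F.1.2.2.2)).trans ?_
          simp only [Prod.smul_snd, Prod.smul_fst, smul_add, smul_neg, RingHom.id_apply]
          rw [smul_comm]
        · refine (congrArg₂ (fun a b => -((Complex.I * ω) • b) - a) e4
            ((J Ω).map_smul c F.1.2.1)).trans ?_
          simp only [Prod.smul_snd, smul_sub, smul_neg, RingHom.id_apply]
          rw [smul_comm] }

end operators

end Waveguide

end

/-! Rotation by `J` turns divergence into curl: `curl (J f) = div f`, with equality of domains, both
on `Ω` and for zero extensions (`hasWeakCurl_J_iff`, `J_mem_H0curl_iff`). Moreover `J² = -1`. Write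
`c = iω`.

The range satisfies the constraints because gradients are curl free. The curl of `-∇u + c J z` is
therefore `c div z`, which is `c` times the third component of the image. The curl of `-c J v - ∇₀w`
is `-c div v`, which is `-c` times the first. The boundary condition in `H⁰_curl` needs more than
this: the zero extension of `∇₀w` must be curl free on the whole plane. That follows by passing
integration by parts to the limit from test functions on `Ω`, while testing against functions whose
support may cross the boundary (`pairing_of_mem_closure_testGraph`, `hasWeakCurl_zeroExt_grad0`).

Conversely, since `c ≠ 0`, the constraints can be solved algebraically with no potentials at all:
with `u = w = 0`, the vector components determine `z = -c⁻¹ J f_∥` and `v = c⁻¹ J g_∥`, and the two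
curl conditions are then exactly the scalar equations `div z = g_⊥` and `div v = f_⊥`. -/

namespace Waveguide

/-! ### Derivatives of test functions -/

section calculus

variable {U : Opens Plane}

lemma contDiff_pderiv (j : Fin 2) (φ : TestFn U) : ContDiff ℝ (⊤ : ℕ∞) (pderiv j φ) :=
  (φ.contDiff.fderiv_right (m := (⊤ : ℕ∞)) (by simp)).clm_apply contDiff_const

/-- The partial derivative of a test function, as a test function. -/
noncomputable def pderivTestFn (j : Fin 2) (φ : TestFn U) : TestFn U where
  toFun := pderiv j φ
  contDiff' := contDiff_pderiv j φ
  hasCompactSupport' := hasCompactSupport_pderiv j φ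
  tsupport_subset' := (tsupport_fderiv_apply_subset ℝ _).trans φ.tsupport_subset

lemma coe_pderivTestFn (j : Fin 2) (φ : TestFn U) :
    (pderivTestFn j φ : Plane → ℂ) = pderiv j φ := rfl

/-- Symmetry of the second derivative; it is what makes the weak curl of a gradient vanish. -/
lemma pderiv_comm (i j : Fin 2) (φ : TestFn U) :
    pderiv i (pderiv j φ) = pderiv j (pderiv i φ) := by
  funext x
  have hd : DifferentiableAt ℝ (fderiv ℝ (φ : Plane → ℂ)) x :=
    ((φ.contDiff.fderiv_right (m := (⊤ : ℕ∞)) (by simp)).differentiable (by simp)) x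
  have hs : IsSymmSndFDerivAt ℝ (φ : Plane → ℂ) x :=
    (φ.contDiff.contDiffAt).isSymmSndFDerivAt
      (by
        rw [minSmoothness_of_isRCLikeNormedField]
        exact WithTop.coe_le_coe.2 (le_top : (2 : ℕ∞) ≤ ⊤))
  have key : ∀ k l : Fin 2, pderiv k (pderiv l φ) x =
      fderiv ℝ (fderiv ℝ (φ : Plane → ℂ)) x (EuclideanSpace.single k 1)
        (EuclideanSpace.single l 1) := by
    intro k l
    have h : pderiv l φ =
        fun y => fderiv ℝ (φ : Plane → ℂ) y (EuclideanSpace.single l (1 : ℝ)) := rfl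
    rw [h, pderiv, fderiv_clm_apply hd (differentiableAt_const _)]
    simp
  rw [key, key]
  exact hs _ _

/-- Integration by parts for two test functions. -/
lemma integral_pderiv_mul {V : Opens Plane} (j : Fin 2) (φ : TestFn U) (ψ : TestFn V) :
    ∫ x, pderiv j φ x * ψ x = -∫ x, φ x * pderiv j ψ x := by
  have hi : ∀ a b : Plane → ℂ, Continuous a → HasCompactSupport a → Continuous b →
      Integrable (fun x => a x * b x) volume := fun a b ha hc hb =>
    Continuous.integrable_of_hasCompactSupport (ha.mul hb) (hc.mul_right (f' := b))
  have hφ : Differentiable ℝ (φ : Plane → ℂ) := φ.contDiff.differentiable (by simp)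
  have hψ : Differentiable ℝ (ψ : Plane → ℂ) := ψ.contDiff.differentiable (by simp)
  have h := integral_mul_fderiv_eq_neg_fderiv_mul_of_integrable (𝕜 := ℂ) (μ := volume)
    (f := (φ : Plane → ℂ)) (g := (ψ : Plane → ℂ)) (v := EuclideanSpace.single j (1 : ℝ))
    (hi _ _ (continuous_pderiv j φ) (hasCompactSupport_pderiv j φ) (continuous_testFn ψ))
    (hi _ _ (continuous_testFn φ) φ.hasCompactSupport (continuous_pderiv j ψ))
    (hi _ _ (continuous_testFn φ) φ.hasCompactSupport (continuous_testFn ψ))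
    (fun x _ => hφ x) (fun x _ => hψ x)
  exact (neg_eq_iff_eq_neg.mpr h).symm

end calculus

/-! ### Pairings of `L₂` functions with test functions, and curls of gradients -/

section pairings

variable {Ω U : Opens Plane}

/-- The pairing is the inner product with the conjugate of `a`, which lies in `L₂` because `a` is
continuous with compact support. -/
lemma continuous_pairing {s : Set Plane} {a : Plane → ℂ} (ha : Continuous a)
    (hc : HasCompactSupport a) :
    Continuous fun u : Lp ℂ 2 (volume.restrict s) => ∫ x in s, a x * u x := by
  have hm : MemLp (fun x => star (a x)) 2 (volume.restrict s) :=
    (ha.memLp_of_hasCompactSupport (p := 2) hc).star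
  have h : (fun u : Lp ℂ 2 (volume.restrict s) => ∫ x in s, a x * u x) =
      fun u => inner ℂ (hm.toLp _) u := by
    funext u
    rw [L2.inner_def]
    refine integral_congr_ae ?_
    filter_upwards [hm.coeFn_toLp] with x hx
    rw [hx]
    simp [mul_comm]
  rw [h]
  exact continuous_const.inner continuous_id

lemma continuous_pairing_comp {s : Set Plane} {a : Plane → ℂ} (ha : Continuous a)
    (hc : HasCompactSupport a) (j : Fin 2) :
    Continuous fun f : Lp C2 2 (volume.restrict s) => ∫ x in s, a x * f x j := by
  have h := (continuous_pairing (s := s) ha hc).comp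
    ((EuclideanSpace.proj (𝕜 := ℂ) j : C2 →L[ℂ] ℂ).compLpL 2 (volume.restrict s)).continuous
  refine h.congr fun f => integral_congr_ae ?_
  filter_upwards [(EuclideanSpace.proj (𝕜 := ℂ) j : C2 →L[ℂ] ℂ).coeFn_compLpL f] with x hx
  simp [hx]

/-- The curl of a gradient vanishes: if `u` and `g` satisfy the integration by parts formula for
all test functions on `U`, then the pairings of `curl g` with them vanish. -/
lemma curl_pairing_grad {s : Set Plane} {u : Plane → ℂ} {g : Lp C2 2 (volume.restrict s)}
    (h : ∀ φ : TestFn U, ∀ j : Fin 2,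
      ∫ x in s, pderiv j φ x * u x = -∫ x in s, φ x * g x j) (φ : TestFn U) :
    ∫ x in s, (pderiv 0 φ x * g x 1 - pderiv 1 φ x * g x 0) = 0 := by
  rw [integral_sub
    (integrable_mul_of (continuous_pderiv 0 φ) (hasCompactSupport_pderiv 0 φ)
      (memLp_comp_apply g 1))
    (integrable_mul_of (continuous_pderiv 1 φ) (hasCompactSupport_pderiv 1 φ)
      (memLp_comp_apply g 0))]
  -- Each term of the curl pairing is a gradient pairing against a first derivative of `φ`; both
  -- equal minus the pairing of `u` with the same mixed second derivative.
  have h0 := h (pderivTestFn 0 φ) 1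
  have h1 := h (pderivTestFn 1 φ) 0
  rw [coe_pderivTestFn] at h0 h1
  rw [pderiv_comm 1 0, h1] at h0
  exact sub_eq_zero.2 (neg_injective h0).symm

/-- Functions in `H¹₀(Ω)` satisfy the integration by parts formula for all test functions on the
plane. -/
lemma pairing_of_mem_closure_testGraph {p : L2 Ω × L2v Ω}
    (hp : p ∈ (testGraph Ω).topologicalClosure) (φ : TestFn U) (j : Fin 2) :
    ∫ x in (Ω : Set Plane), pderiv j φ x * p.1 x = -∫ x in (Ω : Set Plane), φ x * p.2 x j := by
  -- For fixed `φ` both sides are continuous in `p`, so it suffices to check the formula on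
  -- `testGraph`.
  have hcl : IsClosed {p : L2 Ω × L2v Ω | ∫ x in (Ω : Set Plane), pderiv j φ x * p.1 x =
      -∫ x in (Ω : Set Plane), φ x * p.2 x j} :=
    isClosed_eq
      ((continuous_pairing (continuous_pderiv j φ) (hasCompactSupport_pderiv j φ)).comp
        continuous_fst)
      ((continuous_pairing_comp (continuous_testFn φ) φ.hasCompactSupport j).comp
        continuous_snd).neg
  refine hcl.closure_subset_iff.2 ?_ hp
  rintro q ⟨ψ, h1, h2⟩
  -- Since `ψ` and its derivatives vanish off `Ω`, the integrals extend to the plane, where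
  -- integration by parts has no boundary term even if `φ` is not supported in `Ω`.
  have zero_off : ∀ (θ : TestFn Ω) (x : Plane), x ∉ (Ω : Set Plane) → θ x = 0 := fun θ x hx =>
    image_eq_zero_of_notMem_tsupport fun hx' => hx (θ.tsupport_subset hx')
  have e1 : ∫ x in (Ω : Set Plane), pderiv j φ x * q.1 x = ∫ x, pderiv j φ x * ψ x := by
    rw [← setIntegral_eq_integral_of_forall_compl_eq_zero (s := (Ω : Set Plane))
      (f := fun x => pderiv j φ x * ψ x) fun x hx => by simp only [zero_off ψ x hx, mul_zero]]
    refine integral_congr_ae ?_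
    filter_upwards [h1] with x hx
    rw [hx]
  have e2 : ∫ x in (Ω : Set Plane), φ x * q.2 x j = ∫ x, φ x * pderivTestFn j ψ x := by
    rw [← setIntegral_eq_integral_of_forall_compl_eq_zero (s := (Ω : Set Plane))
      (f := fun x => φ x * pderivTestFn j ψ x) fun x hx => by simp only [zero_off (pderivTestFn j ψ) x hx, mul_zero]]
    refine integral_congr_ae ?_
    filter_upwards [h2 j] with x hx
    rw [hx, coe_pderivTestFn]
  exact e1.trans ((integral_pderiv_mul j φ ψ).trans (congrArg Neg.neg e2.symm))

end pairings

/-! ### Rotation by `J`: exchanging divergence and curl -/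

section rotation

variable (Ω : Opens Plane)

lemma coeFn_J (f : L2v Ω) :
    ∀ᵐ x ∂volume.restrict (Ω : Set Plane), J Ω f x 0 = -f x 1 ∧ J Ω f x 1 = f x 0 := by
  filter_upwards [(Matrix.toEuclideanCLM (n := Fin 2) (𝕜 := ℂ)
    !![0, -1; 1, 0]).coeFn_compLpL (p := 2) f] with x hx
  rw [J, hx]
  simp [Matrix.ofLp_toEuclideanCLM, Matrix.mulVec, dotProduct]

lemma J_J (f : L2v Ω) : J Ω (J Ω f) = -f := by
  refine Lp.ext ?_
  filter_upwards [coeFn_J Ω f, coeFn_J Ω (J Ω f), Lp.coeFn_neg f] with x h1 h2 h3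
  rw [h3]
  ext j
  fin_cases j
  · simp [h2.1, h1.2]
  · simp [h2.2, h1.1]

lemma setIntegral_curl_zeroExt (a b : Plane → ℂ) (f : Plane → C2) :
    ∫ x in ((⊤ : Opens Plane) : Set Plane), (a x * zeroExt Ω f x 1 - b x * zeroExt Ω f x 0) =
      ∫ x in (Ω : Set Plane), (a x * f x 1 - b x * f x 0) := by
  rw [Opens.coe_top, Measure.restrict_univ, ← integral_indicator Ω.isOpen.measurableSet]
  congr 1
  funext x
  by_cases hx : x ∈ (Ω : Set Plane) <;> simp [zeroExt, hx]

/-- Pointwise, `J f = (-f₂, f₁)`. With `a`, `b` the partial derivatives of a test function this is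
`curl (J f) = div f`. -/
lemma curl_pairing_J (a b : Plane → ℂ) (f : L2v Ω) :
    ∫ x in (Ω : Set Plane), (a x * J Ω f x 1 - b x * J Ω f x 0) =
      ∫ x in (Ω : Set Plane), (a x * f x 0 + b x * f x 1) := by
  refine integral_congr_ae ?_
  filter_upwards [coeFn_J Ω f] with x hx
  rw [hx.1, hx.2]
  ring

lemma hasWeakCurl_J_iff (f : L2v Ω) (h : Plane → ℂ) :
    HasWeakCurl Ω (J Ω f) h ↔ HasWeakDiv Ω f h :=
  forall_congr' fun φ => by rw [curl_pairing_J]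

lemma hasWeakCurl_zeroExt_J_iff (f : L2v Ω) (h : Plane → ℂ) :
    HasWeakCurl ⊤ (zeroExt Ω (J Ω f)) h ↔ HasWeakDiv ⊤ (zeroExt Ω f) h :=
  forall_congr' fun φ => by rw [setIntegral_curl_zeroExt, setIntegral_zeroExt, curl_pairing_J]

lemma J_mem_Hcurl_iff (f : L2v Ω) : J Ω f ∈ Hcurl Ω ↔ f ∈ Hdiv Ω := by
  rw [mem_Hcurl_iff, mem_Hdiv_iff]
  exact exists_congr fun h => hasWeakCurl_J_iff Ω f h

/-- `J` acts pointwise, so it is compatible with zero extension and the identity `curl (J f) = div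
f` also holds on the plane. -/
lemma J_mem_H0curl_iff (f : L2v Ω) : J Ω f ∈ H0curl Ω ↔ f ∈ H0div Ω :=
  and_congr (J_mem_Hcurl_iff Ω f) (exists_congr fun h => hasWeakCurl_zeroExt_J_iff Ω f h)

/-- The difference of two pairs in `curlGraph` over the same `f` has first component zero, hence
vanishes. -/
lemma curl_eq_of_hasWeakCurl {f : L2v Ω} (hf : f ∈ Hcurl Ω) {h : L2 Ω} (hh : HasWeakCurl Ω f h) :
    curl Ω ⟨f, hf⟩ = h := by
  have h1 : (f, curl Ω ⟨f, hf⟩) ∈ curlGraph Ω := hasWeakCurl_curl Ω ⟨f, hf⟩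
  have h2 : (f, h) ∈ curlGraph Ω := hh
  exact sub_eq_zero.1 (curl_single_valued Ω _ (sub_mem h1 h2) (sub_self f))

lemma div_eq_of_hasWeakDiv {f : L2v Ω} (hf : f ∈ Hdiv Ω) {h : L2 Ω} (hh : HasWeakDiv Ω f h) :
    div Ω ⟨f, hf⟩ = h := by
  have h1 : (f, div Ω ⟨f, hf⟩) ∈ divGraph Ω := hasWeakDiv_div Ω ⟨f, hf⟩
  have h2 : (f, h) ∈ divGraph Ω := hh
  exact sub_eq_zero.1 (div_single_valued Ω _ (sub_mem h1 h2) (sub_self f))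

/-- `curl` of a gradient vanishes. -/
lemma hasWeakCurl_grad (u : H1 Ω) : HasWeakCurl Ω (grad Ω u) (0 : L2 Ω) := by
  intro φ
  rw [curl_pairing_grad (hasWeakGrad_grad Ω u) φ, pairing_smul (u := 0) 0
    (by rw [zero_smul]; exact Lp.coeFn_zero _ _ _), zero_mul, neg_zero]

/-- The zero extension of the gradient of a function in `H¹₀(Ω)` is curl free. -/
lemma hasWeakCurl_zeroExt_grad0 (u : H10 Ω) :
    HasWeakCurl ⊤ (zeroExt Ω (grad0 Ω u)) (0 : Lp ℂ 2 (volume : Measure Plane)) := by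
  intro φ
  obtain ⟨p, ⟨hp, hpc⟩, hpu⟩ := u.2
  have hu : ((u : L2 Ω), grad0 Ω u) ∈ gradGraph Ω :=
    hasWeakGrad_grad Ω (Submodule.inclusion (H10_le_H1 Ω) u)
  -- The limit of the gradients of the approximating test functions is the weak gradient itself, by
  -- uniqueness.
  have hpg : p.2 = grad0 Ω u :=
    sub_eq_zero.1 (grad_single_valued Ω _ (sub_mem hp hu) (sub_eq_zero.2 hpu))
  rw [setIntegral_curl_zeroExt, ← hpg,
    curl_pairing_grad (fun φ j => pairing_of_mem_closure_testGraph hpc φ j) φ,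
    pairing_smul (u := 0) 0 (by
      rw [zero_smul, Opens.coe_top, Measure.restrict_univ]
      exact Lp.coeFn_zero _ _ _), zero_mul, neg_zero]

lemma grad0_mem_H0curl (u : H10 Ω) : grad0 Ω u ∈ H0curl Ω :=
  ⟨(mem_Hcurl_iff Ω _).2 ⟨0, hasWeakCurl_grad Ω (Submodule.inclusion (H10_le_H1 Ω) u)⟩,
    0, hasWeakCurl_zeroExt_grad0 Ω u⟩

/-- Follows from `J² = -1`. As `H0curl` is only a set while `H0div` is a submodule, this is also how
linear combinations in `H0curl` are handled. -/
lemma mem_H0curl_iff (f : L2v Ω) : f ∈ H0curl Ω ↔ J Ω f ∈ H0div Ω := by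
  have h : J Ω (-J Ω f) = f := by rw [map_neg, J_J, neg_neg]
  rw [← neg_mem_iff, ← J_mem_H0curl_iff, h]

end rotation

end Waveguide

/-! ### The range of the Maxwell operator -/

open Waveguide in
theorem proposition2p7 (Ω : TopologicalSpace.Opens Waveguide.Plane)
    (hΩb : Bornology.IsBounded (Ω : Set Waveguide.Plane)) (hΩ : Waveguide.IsWeaklyLipschitz Ω)
    (ω : ℂ) (hω : ω ≠ 0) :
    Set.range (Waveguide.maxwellD Ω ω) =
      {p : Waveguide.L2six Ω | ∃ (f_perp : Waveguide.L2 Ω) (f_par : Waveguide.L2v Ω)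
        (g_perp : Waveguide.L2 Ω) (g_par : Waveguide.L2v Ω),
        p = (f_perp, f_par, g_perp, g_par) ∧
        ∃ (hf : f_par ∈ Waveguide.Hcurl Ω) (hg : g_par ∈ Waveguide.H0curl Ω),
          Waveguide.curl Ω ⟨f_par, hf⟩ - (Complex.I * ω) • g_perp = 0 ∧
          Waveguide.curl Ω ⟨g_par, Waveguide.H0curl_subset_Hcurl Ω hg⟩
            + (Complex.I * ω) • f_perp = 0} := by
  
  have hc : Complex.I * ω ≠ 0 := mul_ne_zero Complex.I_ne_zero hω
  set c := Complex.I * ω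
  ext p
  constructor
  · rintro ⟨⟨⟨u, v, w, z⟩, hu, hv, hw, hz⟩, rfl⟩
    have hgu : grad Ω ⟨u, hu⟩ ∈ Hcurl Ω := (mem_Hcurl_iff Ω _).2 ⟨0, hasWeakCurl_grad Ω ⟨u, hu⟩⟩
    have hJz : J Ω z ∈ Hcurl Ω := (J_mem_Hcurl_iff Ω z).2 hz
    have hgw : grad0 Ω ⟨w, hw⟩ ∈ H0curl Ω := grad0_mem_H0curl Ω ⟨w, hw⟩
    have hg : -(c • J Ω v) - grad0 Ω ⟨w, hw⟩ ∈ H0curl Ω := by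
      -- After rotation the claim lives in the submodule `H0div`, where `J` applied to `-c J v` is
      -- just `c v`.
      rw [mem_H0curl_iff] at hgw ⊢
      rw [map_sub, map_neg, map_smul, J_J]
      exact sub_mem (neg_mem (Submodule.smul_mem _ c (neg_mem hv))) hgw
    have hf : -grad Ω ⟨u, hu⟩ + c • J Ω z ∈ Hcurl Ω :=
      add_mem (neg_mem hgu) (Submodule.smul_mem _ c hJz)
    refine ⟨_, _, _, _, rfl, hf, hg, ?_, ?_⟩
    · have e1 : (grad Ω ⟨u, hu⟩, (0 : L2 Ω)) ∈ curlGraph Ω := hasWeakCurl_grad Ω ⟨u, hu⟩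
      have e2 : (J Ω z, div Ω ⟨z, hz⟩) ∈ curlGraph Ω :=
        (hasWeakCurl_J_iff Ω z _).2 (hasWeakDiv_div Ω ⟨z, hz⟩)
      have e := add_mem (neg_mem e1) (Submodule.smul_mem _ c e2)
      have e' : (-grad Ω ⟨u, hu⟩ + c • J Ω z, c • div Ω ⟨z, hz⟩) ∈ curlGraph Ω := by
        simpa using e
      rw [curl_eq_of_hasWeakCurl Ω hf e']
      exact sub_self _
    · have e1 : (grad0 Ω ⟨w, hw⟩, (0 : L2 Ω)) ∈ curlGraph Ω :=
        hasWeakCurl_grad Ω (Submodule.inclusion (H10_le_H1 Ω) ⟨w, hw⟩)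
      have e2 : (J Ω v, div Ω ⟨v, hv.1⟩) ∈ curlGraph Ω :=
        (hasWeakCurl_J_iff Ω v _).2 (hasWeakDiv_div Ω ⟨v, hv.1⟩)
      have e := sub_mem (neg_mem (Submodule.smul_mem _ c e2)) e1
      have e' : (-(c • J Ω v) - grad0 Ω ⟨w, hw⟩, -(c • div Ω ⟨v, hv.1⟩)) ∈ curlGraph Ω := by
        simpa using e
      rw [curl_eq_of_hasWeakCurl Ω hg.1 e']
      exact neg_add_cancel _
  · rintro ⟨f_perp, f_par, g_perp, g_par, rfl, hf, hg, h1, h2⟩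
    -- The sign in the witness for `z` compensates `J² = -1`, so that `c J z = f_par`; for `v` the
    -- minus sign is kept, to cancel the one in the last row of `D`.
    have hJz : c • J Ω (-(c⁻¹ • J Ω f_par)) = f_par := by
      rw [map_neg, map_smul, J_J, smul_neg, smul_neg, smul_neg, neg_neg, smul_inv_smul₀ hc]
    have hJv : c • J Ω (c⁻¹ • J Ω g_par) = -g_par := by
      rw [map_smul, J_J, smul_inv_smul₀ hc]
    have hz : HasWeakDiv Ω (-(c⁻¹ • J Ω f_par) : L2v Ω) g_perp := by
      have e := Submodule.smul_mem _ c⁻¹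
        (show (f_par, curl Ω ⟨f_par, hf⟩) ∈ curlGraph Ω from hasWeakCurl_curl Ω ⟨f_par, hf⟩)
      rw [sub_eq_zero.1 h1, Prod.smul_mk, inv_smul_smul₀ hc] at e
      rw [← hasWeakCurl_J_iff, ← inv_smul_smul₀ hc (J Ω (-(c⁻¹ • J Ω f_par))), hJz]
      exact e
    have hv : HasWeakDiv Ω (c⁻¹ • J Ω g_par : L2v Ω) f_perp := by
      -- The factor is `-c⁻¹` because `J v = -c⁻¹ g_par` and `curl g_par = -c f_perp`: the two signs
      -- cancel in `div v = curl (J v)`.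
      have e := Submodule.smul_mem _ (-c⁻¹)
        (show (g_par, curl Ω ⟨g_par, hg.1⟩) ∈ curlGraph Ω from hasWeakCurl_curl Ω ⟨g_par, hg.1⟩)
      rw [eq_neg_of_add_eq_zero_left h2, Prod.smul_mk, neg_smul, neg_smul, smul_neg, neg_neg,
        inv_smul_smul₀ hc] at e
      rw [← hasWeakCurl_J_iff, ← inv_smul_smul₀ hc (J Ω (c⁻¹ • J Ω g_par)), hJv, smul_neg]
      exact e
    have hzm : -(c⁻¹ • J Ω f_par) ∈ Hdiv Ω := (mem_Hdiv_iff Ω _).2 ⟨_, hz⟩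
    have hvm : c⁻¹ • J Ω g_par ∈ H0div Ω := Submodule.smul_mem _ _ ((mem_H0curl_iff Ω _).1 hg)
    -- No gradients are needed: the `J` terms alone produce `f_par` and `g_par`.
    refine ⟨⟨(0, c⁻¹ • J Ω g_par, 0, -(c⁻¹ • J Ω f_par)),
      zero_mem _, hvm, zero_mem _, hzm⟩, ?_⟩
    refine Prod.ext (div_eq_of_hasWeakDiv Ω hvm.1 hv)
      (Prod.ext ?_ (Prod.ext (div_eq_of_hasWeakDiv Ω hzm hz) ?_))
    · refine (congrArg₂ (fun a b => -a + b) (grad Ω).map_zero hJz).trans ?_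
      rw [neg_zero, zero_add]
    · refine (congrArg₂ (fun a b => -b - a) (grad0 Ω).map_zero hJv).trans ?_
      rw [neg_neg, sub_zero]
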